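/- Let $G$ be a compact Hausdorff topological group and $\varphi:G\to G$ a group endomorphism (continuity of $\varphi$ is not needed). The Reidemeister classes of $\varphi$ are the sets $\{xg\varphi(x^{-1}) : x\in G\}$, $g\in G$; their number is $R(\varphi)$; a $\varphi$-class function is a function $f:G\to\mathbb C$ that is constant on every Reidemeister class. A matrix coefficient of a representation $\rho$ of $G$ on a complex vector space $V$ is a function $g\mapsto \ell(\rho(g))$, where $\ell$ is a linear functional on the space of linear endomorphisms of $V$. (1) Let $\rho$ be a continuous irreducible representation of $G$ on a finite-dimensional complex vector space. Then $\rho\sim\rho\circ\varphi$ if and only if some nonzero $\varphi$-class function is a matrix coefficient of $\rho$. (2) If $\rho\sim\rho\circ\varphi$ in (1), then the function there is unique up to scaling, and the nonzero $\varphi$-class functions which are matrix coefficients of $\rho$ are exactly the functions $$T_{S,\rho}: g\mapsto \operatorname{Tr}(S\circ\rho(g)),$$ where $S\neq 0$ is an intertwining operator from $\rho$ to $\rho\circ\varphi$, i.e. $\rho(\varphi(x))S=S\rho(x)$ for all $x\in G$. (3) Let $\widehat G$ be the set of unitary equivalence classes of irreducible (strongly continuous) unitary representations of $G$ on nonzero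 complex Hilbert spaces, let $F$ be the set of all $[\rho]\in\widehat G$ with $\rho\sim\rho\circ\varphi$, and let $RT(\varphi)\in\{0,1,2,\dots,\infty\}$ be the number of elements of $F$. One says that TBFT (the twisted Burnside–Frobenius theorem) is true for $\varphi$ if $R(\varphi)=RT(\varphi)$ whenever at least one of these numbers is finite. For every $[\rho]\in F$ there is a nonzero $\varphi$-class function $T_{[\rho]}$ that is a matrix coefficient of $\rho$. For every choice of such functions, the family $(T_{[\rho]})_{[\rho]\in F}$ is a (linear) basis of the space of all $\varphi$-class functions if and only if at least one of $R(\varphi)$, $RT(\varphi)$ is finite and TBFT is true for $\varphi$. In particular, if one of these numbers is finite, TBFT is true for $\varphi$ if and only if these functions form a basis of the space of $\varphi$-class functions. -/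

import Mathlib

universe u v w

noncomputable section

namespace Reidemeister

section Classes

variable {G : Type u} [Group G]

/-- Twisted conjugacy: `g ∼ x g φ(x⁻¹)`. -/
def twistedConj (φ : G →* G) : Setoid G where
  r g h := ∃ x : G, h = x * g * φ x⁻¹
  iseqv :=
    { refl := fun g => ⟨1, by simp⟩
      symm := by
        rintro g h ⟨x, rfl⟩
        exact ⟨x⁻¹, by simp [mul_assoc]⟩
      trans := by
        rintro g h k ⟨x, rfl⟩ ⟨y, rfl⟩
        exact ⟨y * x, by simp [mul_assoc]⟩ }

/-- The Reidemeister number `R(φ)`: the number of twisted conjugacy classes. -/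
def reidemeisterNumber (φ : G →* G) : ℕ∞ :=
  ENat.card (Quotient (twistedConj φ))

/-- The space of `φ`-class functions: functions that are constant on Reidemeister classes. -/
def classFunctions (φ : G →* G) : Submodule ℂ (G → ℂ) where
  carrier := {f | ∀ g h : G, (twistedConj φ).r g h → f g = f h}
  add_mem' := by
    intro a b ha hb g h r
    simp only [Pi.add_apply, ha g h r, hb g h r]
  zero_mem' := fun _ _ _ => rfl
  smul_mem' := by
    intro c a ha g h r
    simp only [Pi.smul_apply, ha g h r]

/-- A matrix coefficient of `ρ`: a function `g ↦ ℓ (ρ g)` with `ℓ` a linear functional on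
the space of endomorphisms of `V`. -/
def IsMatrixCoefficient {V : Type w} [AddCommGroup V] [Module ℂ V]
    (ρ : Representation ℂ G V) (f : G → ℂ) : Prop :=
  ∃ ℓ : Module.Dual ℂ (V →ₗ[ℂ] V), ∀ g : G, f g = ℓ (ρ g)

/-- The representation `ρ ∘ φ`. -/
def twist {V : Type w} [AddCommGroup V] [Module ℂ V]
    (ρ : Representation ℂ G V) (φ : G →* G) : Representation ℂ G V :=
  MonoidHom.comp ρ φ

/-- The function `g ↦ Tr (S ∘ ρ g)`. -/
def traceFunction {V : Type w} [AddCommGroup V] [Module ℂ V]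
    (ρ : Representation ℂ G V) (S : V →ₗ[ℂ] V) : G → ℂ :=
  fun g => LinearMap.trace ℂ V (S ∘ₗ ρ g)

end Classes

section Dual

variable (G : Type u) [Group G] [TopologicalSpace G]

/-- An irreducible (strongly continuous) unitary representation of `G` on a nonzero complex
Hilbert space, of any dimension. -/
structure UnitaryIrrep where
  /-- the Hilbert space -/
  space : Type v
  [normed : NormedAddCommGroup space]
  [hilbert : InnerProductSpace ℂ space]
  [complete : CompleteSpace space]
  /-- the action by unitary operators -/
  action : G →* (space ≃ₗᵢ[ℂ] space)
  continuous_action : ∀ x : space, Continuous fun g => action g x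
  nontrivial : Nontrivial space
  irreducible : ∀ K : Submodule ℂ space, IsClosed (K : Set space) →
    (∀ g : G, ∀ x ∈ K, action g x ∈ K) → K = ⊥ ∨ K = ⊤

attribute [instance] UnitaryIrrep.normed UnitaryIrrep.hilbert UnitaryIrrep.complete

variable {G}

/-- The underlying linear representation. -/
def UnitaryIrrep.toRepresentation (π : UnitaryIrrep.{u, v} G) :
    Representation ℂ G π.space where
  toFun g := (π.action g).toLinearEquiv.toLinearMap
  map_one' := by ext x; simp
  map_mul' g h := by ext x; simp

variable (G)

/-- Unitary equivalence. -/
def unitaryEquivalence : Setoid (UnitaryIrrep.{u, v} G) where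
  r π σ := ∃ U : π.space ≃ₗᵢ[ℂ] σ.space, ∀ (g : G) (x : π.space),
    U (π.action g x) = σ.action g (U x)
  iseqv :=
    { refl := fun π => ⟨LinearIsometryEquiv.refl ℂ π.space, fun _ _ => rfl⟩
      symm := by
        rintro π σ ⟨U, hU⟩
        refine ⟨U.symm, fun g x => U.injective ?_⟩
        rw [hU]
        simp
      trans := by
        rintro π σ τ ⟨U, hU⟩ ⟨W, hW⟩
        exact ⟨U.trans W, fun g x => by simp [hU, hW]⟩ }

/-- The unitary dual of `G`. -/
def UnitaryDual : Type (max u (v + 1)) :=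
  Quotient (unitaryEquivalence.{u, v} G)

variable {G}

/-- The class `[π]` in the unitary dual. -/
def UnitaryIrrep.toDual (π : UnitaryIrrep.{u, v} G) : UnitaryDual.{u, v} G :=
  Quotient.mk (unitaryEquivalence.{u, v} G) π

/-- `π` is unitarily equivalent to `π ∘ φ` (which itself may be reducible in general). -/
def UnitaryIrrep.IsFixed (π : UnitaryIrrep.{u, v} G) (φ : G →* G) : Prop :=
  ∃ U : π.space ≃ₗᵢ[ℂ] π.space, ∀ (g : G) (x : π.space),
    U (π.action g x) = π.action (φ g) (U x)

/-- The property `π ∼ π ∘ φ` depends only on the class of `π`. -/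
theorem UnitaryIrrep.IsFixed.of_toDual_eq {π σ : UnitaryIrrep.{u, v} G} {φ : G →* G}
    (h : π.IsFixed φ) (e : π.toDual = σ.toDual) : σ.IsFixed φ := by
  obtain ⟨U, hU⟩ := h
  obtain ⟨W, hW⟩ := Quotient.exact e
  refine ⟨(W.symm.trans U).trans W, fun g x => ?_⟩
  have h1 : W.symm (σ.action g x) = π.action g (W.symm x) := by
    apply W.injective
    rw [hW]
    simp
  simp [h1, hU, hW]

/-- The points `[π]` of the unitary dual with `π ∼ π ∘ φ`. -/
def FixedPoint (φ : G →* G) : Type (max u (v + 1)) :=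
  {p : UnitaryDual.{u, v} G // ∃ π : UnitaryIrrep.{u, v} G, π.toDual = p ∧ π.IsFixed φ}

/-- The number of classes of irreducible unitary representations with `π ∼ π ∘ φ`. -/
def fixedPointNumber (φ : G →* G) : ℕ∞ :=
  ENat.card (FixedPoint.{u, v} φ)

/-- The twisted Burnside–Frobenius theorem is true for `φ`: the Reidemeister number equals the
number of fixed irreducible unitary representations, if one of these numbers is finite. -/
def TBFT (φ : G →* G) : Prop :=
  (reidemeisterNumber φ < ⊤ ∨ fixedPointNumber.{u, v} φ < ⊤) →
    reidemeisterNumber φ = fixedPointNumber.{u, v} φ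

/-- `T` picks for every fixed point `[π]` a nonzero `φ`-class function that is a matrix
coefficient of (a representative of) `[π]`. -/
def IsCoefficientSystem (φ : G →* G) (T : FixedPoint.{u, v} φ → G → ℂ) : Prop :=
  ∀ p : FixedPoint.{u, v} φ, T p ≠ 0 ∧ T p ∈ classFunctions φ ∧
    ∃ π : UnitaryIrrep.{u, v} G, π.toDual = p.1 ∧ IsMatrixCoefficient π.toRepresentation (T p)

end Dual

end Reidemeister

end

/-!
By Burnside's theorem the operators `ρ g` of an irreducible finite-dimensional representation span
`End V`, so every matrix coefficient of `ρ` is `g ↦ Tr (S ∘ ρ g)` for a unique `S`. Cyclicity of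
the trace turns invariance under twisted conjugation into `ρ (φ x) ∘ S = S ∘ ρ x`; Schur's lemma
then says that such an `S` is unique up to scaling and invertible unless it is zero.

On a compact group, the Haar average of the projections onto the lines of an orbit is a nonzero
compact self-adjoint intertwiner. Its eigenspace for a nonzero eigenvalue is finite-dimensional
and invariant, so irreducible unitary representations are finite-dimensional. Jacobson density for
a finite family of inequivalent irreducible representations shows that their nonzero matrix
coefficients are linearly independent, which leaves a comparison of dimensions: the class
functions are all functions on the set of Reidemeister classes. If the coefficients span them,
every class function is continuous, so the compact space of Reidemeister classes is discrete,
hence finite.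
-/

namespace Reidemeister

open MeasureTheory Representation
open scoped MonoidAlgebra InnerProductSpace

section Density

section Module

variable {k A ι : Type*} [Field k] [IsAlgClosed k] [Ring A] [Algebra k A] [Finite ι]
  {M : ι → Type*} [∀ i, AddCommGroup (M i)] [∀ i, Module k (M i)] [∀ i, Module A (M i)]
  [∀ i, IsScalarTower k A (M i)] [∀ i, FiniteDimensional k (M i)] [∀ i, IsSimpleModule A (M i)]

theorem exists_end_pi_eq_smul (hM : Pairwise fun i j => IsEmpty (M i ≃ₗ[A] M j))
    (e : Module.End A (∀ i, M i)) : ∃ c : ι → k, ∀ x i, e x i = c i • x i := by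
  classical
  have := Fintype.ofFinite ι
  let entry (i j : ι) : M j →ₗ[A] M i := LinearMap.proj i ∘ₗ e ∘ₗ LinearMap.single A M j
  have entry_of_ne {i j : ι} (hji : j ≠ i) : entry i j = 0 :=
    (LinearMap.bijective_or_eq_zero _).resolve_left fun h =>
      (hM hji).false (LinearEquiv.ofBijective _ h)
  have entry_self (i : ι) : ∃ c : k, ∀ y, entry i i y = c • y := by
    obtain ⟨c, hc⟩ :=
      (IsSimpleModule.algebraMap_end_bijective_of_isAlgClosed (A := A) k).2 (entry i i)
    exact ⟨c, fun y => (LinearMap.congr_fun hc y).symm⟩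
  choose c hc using entry_self
  refine ⟨c, fun x i => ?_⟩
  calc e x i = ∑ j, entry i j (x j) := by
        conv_lhs => rw [← Finset.univ_sum_single x, map_sum, Finset.sum_apply]
        rfl
    _ = entry i i (x i) := Finset.sum_eq_single_of_mem i (Finset.mem_univ i) fun j _ hji => by
        rw [entry_of_ne hji, LinearMap.zero_apply]
    _ = c i • x i := hc i (x i)

theorem exists_smul_eq_apply (hM : Pairwise fun i j => IsEmpty (M i ≃ₗ[A] M j))
    (f : ∀ i, Module.End k (M i)) : ∃ a : A, ∀ i x, a • x = f i x := by
  classical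
  -- The Schur lemma above makes `f` commute with every `A`-endomorphism of `∀ i, M i`, which is
  -- what the density theorem requires.
  let F : Module.End (Module.End A (∀ i, M i)) (∀ i, M i) :=
    { toFun := fun x i => f i (x i)
      map_add' := fun x y => funext fun i => map_add (f i) (x i) (y i)
      map_smul' := fun e x => funext fun i => by
        obtain ⟨c, hc⟩ := exists_end_pi_eq_smul (k := k) hM e
        simp only [Module.End.smul_def, RingHom.id_apply, hc, map_smul] }
  have : Module.Finite (Module.End A (∀ i, M i)) (∀ i, M i) :=
    Module.Finite.of_restrictScalars_finite k _ _
  obtain ⟨a, ha⟩ := Module.Finite.toModuleEnd_moduleEnd_surjective (R := A) F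
  refine ⟨a, fun i x => ?_⟩
  have h := congrFun (LinearMap.congr_fun ha (Pi.single i x)) i
  simpa [F] using h

end Module

section Representation

variable {k G ι : Type*} [Field k] [IsAlgClosed k] [Monoid G]

theorem span_range_pi_eq_top [Finite ι] {V : ι → Type*} [∀ i, AddCommGroup (V i)]
    [∀ i, Module k (V i)] [∀ i, FiniteDimensional k (V i)] (ρ : ∀ i, Representation k G (V i))
    [∀ i, (ρ i).IsIrreducible] (hρ : Pairwise fun i j => IsEmpty ((ρ i).Equiv (ρ j))) :
    Submodule.span k (Set.range fun g i => ρ i g) = ⊤ := by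
  have hM : Pairwise fun i j => IsEmpty ((ρ i).asModule ≃ₗ[k[G]] (ρ j).asModule) :=
    fun i j hij => ⟨fun e => (hρ hij).false <|
      ((IntertwiningMap.equivLinearMapAsModule (ρ i) (ρ j)).symm e).ofBijective e.bijective⟩
  have asAlgebraHom_mem (r : k[G]) :
      (fun i => (ρ i).asAlgebraHom r) ∈ Submodule.span k (Set.range fun g i => ρ i g) := by
    induction r using MonoidAlgebra.induction_on with
    | of g =>
      simp only [asAlgebraHom_of]
      exact Submodule.subset_span ⟨g, rfl⟩
    | add r s hr hs =>
      simp only [map_add]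
      exact Submodule.add_mem _ hr hs
    | smul c r hr =>
      simp only [map_smul]
      exact Submodule.smul_mem _ c hr
  refine eq_top_iff.2 fun f _ => ?_
  obtain ⟨r, hr⟩ := exists_smul_eq_apply hM f
  convert asAlgebraHom_mem r using 1
  exact funext fun i => LinearMap.ext fun x => (hr i x).symm

theorem span_range_eq_top {V : Type*} [AddCommGroup V] [Module k V] [FiniteDimensional k V]
    (ρ : Representation k G V) [ρ.IsIrreducible] : Submodule.span k (Set.range ρ) = ⊤ := by
  calc Submodule.span k (Set.range ρ)
      = (Submodule.span k (Set.range fun g (_ : Unit) => ρ g)).map (LinearMap.proj ()) := by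
        rw [Submodule.map_span, ← Set.range_comp]
        rfl
    _ = ⊤ := by
        rw [span_range_pi_eq_top (fun _ : Unit => ρ) Subsingleton.pairwise, Submodule.map_top,
          LinearMap.range_eq_top]
        exact Function.surjective_eval ()

end Representation

end Density

section TracePairing

variable {k V : Type*} [Field k] [AddCommGroup V] [Module k V]

theorem eq_of_forall_trace_mul_eq [FiniteDimensional k V] {S S' : Module.End k V}
    (h : ∀ A, LinearMap.trace k V (S * A) = LinearMap.trace k V (S' * A)) : S = S' := by
  refine LinearMap.ext fun x => sub_eq_zero.1 ?_
  refine (Module.forall_dual_apply_eq_zero_iff k _).1 fun f => ?_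
  have trace_mul_smulRight (T : Module.End k V) :
      LinearMap.trace k V (T * f.smulRight x) = f (T x) := by
    have h : T * f.smulRight x = f.smulRight (T x) := LinearMap.ext fun y => map_smul T (f y) x
    rw [h, LinearMap.trace_smulRight]
  rw [map_sub, ← trace_mul_smulRight, ← trace_mul_smulRight, h, sub_self]

theorem exists_eq_trace_mul [FiniteDimensional k V] (ℓ : Module.Dual k (Module.End k V)) :
    ∃ S : Module.End k V, ∀ A, ℓ A = LinearMap.trace k V (S * A) := by
  let pairing : Module.End k V →ₗ[k] Module.Dual k (Module.End k V) :=
    (LinearMap.mul k (Module.End k V)).compr₂ (LinearMap.trace k V)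
  have pairing_injective : Function.Injective pairing := fun S S' h =>
    eq_of_forall_trace_mul_eq (LinearMap.congr_fun h)
  obtain ⟨S, hS⟩ := (LinearMap.injective_iff_surjective_of_finrank_eq_finrank
    Subspace.dual_finrank_eq.symm).1 pairing_injective ℓ
  exact ⟨S, fun A => (LinearMap.congr_fun hS A).symm⟩

end TracePairing

section Schur

variable {k G V W : Type*} [Field k] [Monoid G] [AddCommGroup V] [Module k V]
  [AddCommGroup W] [Module k W]

theorem intertwiningMap_bijective_of_ne_zero [FiniteDimensional k V] {ρ σ : Representation k G V}
    [ρ.IsIrreducible] {S : IntertwiningMap ρ σ} (hS : S ≠ 0) : Function.Bijective S := by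
  have injective : Function.Injective S :=
    (IsIrreducible.injective_or_eq_zero S).resolve_right hS
  exact ⟨injective, (LinearMap.injective_iff_surjective (f := S.toLinearMap)).1 injective⟩

theorem exists_eq_smul_toIntertwiningMap [IsAlgClosed k] [FiniteDimensional k V]
    {ρ : Representation k G V} {σ : Representation k G W} [ρ.IsIrreducible] (e : ρ.Equiv σ)
    (S : IntertwiningMap ρ σ) : ∃ c : k, S = c • e.toIntertwiningMap := by
  obtain ⟨c, hc⟩ := (IsIrreducible.algebraMap_intertwiningMap_bijective_of_isAlgClosed
    (ρ := ρ)).2 (e.symm.toIntertwiningMap.comp S)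
  refine ⟨c, IntertwiningMap.ext <| LinearMap.ext fun x => ?_⟩
  have hx : c • x = e.symm (S x) := congrArg (fun T : IntertwiningMap ρ ρ => T x) hc
  calc S x = e (e.symm (S x)) := (e.toLinearEquiv.apply_symm_apply (S x)).symm
    _ = c • e x := by rw [← hx, map_smul]

theorem toIntertwiningMap_ne_zero {ρ : Representation k G V} {σ : Representation k G W}
    [ρ.IsIrreducible] (e : ρ.Equiv σ) : e.toIntertwiningMap ≠ 0 := by
  have : Nontrivial V := IsSimpleModule.nontrivial k[G] ρ.asModule
  obtain ⟨x, hx⟩ := exists_ne (0 : V)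
  intro h
  have hex : e.toLinearEquiv x = 0 := congrArg (fun T : IntertwiningMap ρ σ => T x) h
  exact hx (e.toLinearEquiv.map_eq_zero_iff.1 hex)

end Schur

section TraceFunction

variable {G V : Type*} [Group G] [AddCommGroup V] [Module ℂ V]
  {φ : G →* G} {ρ : Representation ℂ G V}

theorem traceFunction_twistedConj (S : V →ₗ[ℂ] V) (x g : G) :
    traceFunction ρ S (x * g * φ x⁻¹) = traceFunction ρ (ρ (φ x⁻¹) ∘ₗ S ∘ₗ ρ x) g := by
  simp only [traceFunction, ← Module.End.mul_eq_comp, map_mul ρ, mul_assoc]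
  rw [LinearMap.trace_mul_comm ℂ (ρ (φ x⁻¹))]
  simp only [mul_assoc]

variable [FiniteDimensional ℂ V]

theorem isMatrixCoefficient_iff {f : G → ℂ} :
    IsMatrixCoefficient ρ f ↔ ∃ S, f = traceFunction ρ S := by
  constructor
  · rintro ⟨ℓ, hℓ⟩
    obtain ⟨S, hS⟩ := exists_eq_trace_mul ℓ
    exact ⟨S, funext fun g => (hℓ g).trans (hS (ρ g))⟩
  · rintro ⟨S, rfl⟩
    exact ⟨LinearMap.trace ℂ V ∘ₗ LinearMap.mulLeft ℂ S, fun _ => rfl⟩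

theorem traceFunction_injective [ρ.IsIrreducible] : Function.Injective (traceFunction ρ) := by
  intro S S' h
  have trace_eq : LinearMap.trace ℂ V ∘ₗ LinearMap.mulLeft ℂ S =
      LinearMap.trace ℂ V ∘ₗ LinearMap.mulLeft ℂ S' :=
    LinearMap.ext_on_range (span_range_eq_top ρ) (congrFun h)
  exact eq_of_forall_trace_mul_eq (LinearMap.congr_fun trace_eq)

theorem traceFunction_eq_zero_iff [ρ.IsIrreducible] {S : V →ₗ[ℂ] V} :
    traceFunction ρ S = 0 ↔ S = 0 := by
  have traceFunction_zero : traceFunction ρ 0 = 0 := by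
    funext g
    simp [traceFunction]
  rw [← traceFunction_zero, traceFunction_injective.eq_iff]

theorem traceFunction_mem_classFunctions_iff [ρ.IsIrreducible] {S : V →ₗ[ℂ] V} :
    traceFunction ρ S ∈ classFunctions φ ↔ ∀ x, S ∘ₗ ρ x = ρ (φ x) ∘ₗ S := by
  have mem_iff : traceFunction ρ S ∈ classFunctions φ ↔
      ∀ x, S = ρ (φ x⁻¹) ∘ₗ S ∘ₗ ρ x := by
    constructor
    · intro h x
      refine traceFunction_injective (ρ := ρ) (funext fun g => ?_)
      rw [h g _ ⟨x, rfl⟩, traceFunction_twistedConj]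
    · rintro h g _ ⟨x, rfl⟩
      rw [traceFunction_twistedConj, ← h x]
  have left_inv (x : G) : ρ (φ x⁻¹) ∘ₗ ρ (φ x) = LinearMap.id := by
    rw [← Module.End.mul_eq_comp, ← map_mul, ← map_mul, inv_mul_cancel, map_one, map_one]
    rfl
  have right_inv (x : G) : ρ (φ x) ∘ₗ ρ (φ x⁻¹) = LinearMap.id := by
    simpa only [inv_inv] using left_inv x⁻¹
  refine mem_iff.trans (forall_congr' fun x => ⟨fun h => ?_, fun h => ?_⟩)
  · conv_rhs => rw [h, ← LinearMap.comp_assoc, right_inv, LinearMap.id_comp]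
  · rw [h, ← LinearMap.comp_assoc, left_inv, LinearMap.id_comp]

theorem mem_classFunctions_and_isMatrixCoefficient_iff [ρ.IsIrreducible] {f : G → ℂ} :
    f ∈ classFunctions φ ∧ IsMatrixCoefficient ρ f ↔
      ∃ S : IntertwiningMap ρ (twist ρ φ), f = traceFunction ρ S.toLinearMap := by
  constructor
  · rintro ⟨hc, hm⟩
    obtain ⟨S, rfl⟩ := isMatrixCoefficient_iff.1 hm
    exact ⟨⟨S, traceFunction_mem_classFunctions_iff.1 hc⟩, rfl⟩
  · rintro ⟨S, rfl⟩
    exact ⟨traceFunction_mem_classFunctions_iff.2 S.isIntertwining',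
      isMatrixCoefficient_iff.2 ⟨_, rfl⟩⟩

theorem ne_zero_and_mem_and_isMatrixCoefficient_iff [ρ.IsIrreducible] {f : G → ℂ} :
    f ≠ 0 ∧ f ∈ classFunctions φ ∧ IsMatrixCoefficient ρ f ↔
      ∃ S : IntertwiningMap ρ (twist ρ φ), S ≠ 0 ∧ f = traceFunction ρ S.toLinearMap := by
  have toLinearMap_eq_zero {S : IntertwiningMap ρ (twist ρ φ)} : S.toLinearMap = 0 ↔ S = 0 :=
    ⟨fun h => IntertwiningMap.ext h, fun h => congrArg _ h⟩
  rw [mem_classFunctions_and_isMatrixCoefficient_iff]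
  constructor
  · rintro ⟨hf, S, rfl⟩
    exact ⟨S, by rwa [ne_eq, traceFunction_eq_zero_iff, toLinearMap_eq_zero] at hf, rfl⟩
  · rintro ⟨S, hS, rfl⟩
    exact ⟨by rwa [ne_eq, traceFunction_eq_zero_iff, toLinearMap_eq_zero], S, rfl⟩

theorem nonempty_equiv_twist_iff [ρ.IsIrreducible] :
    Nonempty (ρ.Equiv (twist ρ φ)) ↔
      ∃ f : G → ℂ, f ≠ 0 ∧ f ∈ classFunctions φ ∧ IsMatrixCoefficient ρ f := by
  simp only [ne_zero_and_mem_and_isMatrixCoefficient_iff]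
  constructor
  · rintro ⟨e⟩
    exact ⟨_, e.toIntertwiningMap, toIntertwiningMap_ne_zero e, rfl⟩
  · rintro ⟨_, S, hS, -⟩
    exact ⟨S.ofBijective (intertwiningMap_bijective_of_ne_zero hS)⟩

theorem exists_eq_smul_of_isMatrixCoefficient [ρ.IsIrreducible] {f₁ f₂ : G → ℂ} (h₁ : f₁ ≠ 0)
    (hc₁ : f₁ ∈ classFunctions φ) (hm₁ : IsMatrixCoefficient ρ f₁)
    (hc₂ : f₂ ∈ classFunctions φ) (hm₂ : IsMatrixCoefficient ρ f₂) : ∃ c : ℂ, f₂ = c • f₁ := by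
  obtain ⟨S₁, hS₁, rfl⟩ := ne_zero_and_mem_and_isMatrixCoefficient_iff.1 ⟨h₁, hc₁, hm₁⟩
  obtain ⟨S₂, rfl⟩ := mem_classFunctions_and_isMatrixCoefficient_iff.1 ⟨hc₂, hm₂⟩
  obtain ⟨c, rfl⟩ := exists_eq_smul_toIntertwiningMap
    (S₁.ofBijective (intertwiningMap_bijective_of_ne_zero hS₁)) S₂
  refine ⟨c, funext fun g => ?_⟩
  exact map_smul (LinearMap.trace ℂ V ∘ₗ LinearMap.mulRight ℂ (ρ g)) c S₁.toLinearMap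

end TraceFunction

section Independence

variable {G ι : Type*} [Group G] {V : ι → Type*} [∀ i, AddCommGroup (V i)]
  [∀ i, Module ℂ (V i)] [∀ i, FiniteDimensional ℂ (V i)]

theorem linearIndependent_of_isMatrixCoefficient
    (ρ : ∀ i, Representation ℂ G (V i)) [∀ i, (ρ i).IsIrreducible]
    (hρ : Pairwise fun i j => IsEmpty ((ρ i).Equiv (ρ j)))
    {T : ι → G → ℂ} (hT : ∀ i, T i ≠ 0) (hm : ∀ i, IsMatrixCoefficient (ρ i) (T i)) :
    LinearIndependent ℂ T := by
  classical
  choose ℓ hℓ using hm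
  refine linearIndependent_iff_finset_linearIndependent.2 fun s =>
    Fintype.linearIndependent_iff.2 fun c hc i => ?_
  have functional_eq_zero :
      ∑ j : s, c j • (ℓ j ∘ₗ LinearMap.proj (φ := fun j : s => Module.End ℂ (V j)) j) = 0 := by
    refine LinearMap.ext_on_range
      (span_range_pi_eq_top (fun j : s => ρ j) (hρ.comp_of_injective Subtype.val_injective)) ?_
    intro g
    simpa [hℓ] using congrFun hc g
  obtain ⟨g, hg⟩ : ∃ g, T i g ≠ 0 := Function.ne_iff.1 (hT i)
  have h := LinearMap.congr_fun functional_eq_zero (Pi.single i (ρ i g))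
  rw [LinearMap.sum_apply, Finset.sum_eq_single_of_mem i (Finset.mem_univ i)] at h
  · simpa [← hℓ, hg] using h
  · intro j _ hji
    simp [Pi.single_eq_of_ne hji]

end Independence

section CompactOperators

theorem isCompactOperator_rankOne {𝕜 E F : Type*} [RCLike 𝕜] [NormedAddCommGroup E]
    [NormedSpace 𝕜 E] [NormedAddCommGroup F] [InnerProductSpace 𝕜 F] (x : E) (y : F) :
    IsCompactOperator (InnerProductSpace.rankOne 𝕜 x y) := by
  have isCompactOperator_inner : IsCompactOperator (innerSL 𝕜 y) :=
    isCompactOperator_of_locallyCompactSpace_dom _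
  rw [InnerProductSpace.rankOne_def', ContinuousLinearMap.coe_comp]
  exact isCompactOperator_inner.clm_comp _

theorem isCompactOperator_integral {α E F : Type*} [MeasurableSpace α] {μ : Measure α}
    [NormedAddCommGroup E] [NormedSpace ℂ E] [NormedAddCommGroup F] [NormedSpace ℂ F]
    [CompleteSpace F] {f : α → E →L[ℂ] F}
    (hf : ∀ a, IsCompactOperator (f a)) :
    IsCompactOperator (∫ a, f a ∂μ : E →L[ℂ] F) := by
  let K : Submodule ℂ (E →L[ℂ] F) := compactOperator (RingHom.id ℂ) E F
  have : CompleteSpace K := isClosed_setOfPred_isCompactOperator.completeSpace_coe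
  let fK (a : α) : K := ⟨f a, hf a⟩
  have integral_eq : ∫ a, f a ∂μ = K.subtypeₗᵢ (∫ a, fK a ∂μ) :=
    (LinearIsometry.integral_comp_comm (𝕜 := ℂ) K.subtypeₗᵢ fK :)
  rw [integral_eq]
  exact (∫ a, fK a ∂μ).2

end CompactOperators

section AveragedProjection

variable {E : Type*} [NormedAddCommGroup E] [InnerProductSpace ℂ E]
variable {G : Type*} [Group G] [TopologicalSpace G] [IsTopologicalGroup G] [CompactSpace G]
  [MeasurableSpace G] [BorelSpace G] {ρ : G →* (E ≃ₗᵢ[ℂ] E)}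

/-- The Haar average of the rank-one operators `x ↦ ⟪ρ g v, x⟫ • ρ g v`: for `v ≠ 0` a nonzero
compact self-adjoint operator commuting with `ρ`. -/
noncomputable def averagedProjection (ρ : G →* (E ≃ₗᵢ[ℂ] E)) (v : E) : E →L[ℂ] E :=
  ∫ g, InnerProductSpace.rankOne ℂ (ρ g v) (ρ g v) ∂(Measure.haar : Measure G)

theorem integrable_rankOne_orbit {v : E} (hv : Continuous fun g => ρ g v) :
    Integrable (fun g => InnerProductSpace.rankOne ℂ (ρ g v) (ρ g v))
      (Measure.haar : Measure G) :=
  Continuous.integrable_of_hasCompactSupport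
    ((ContinuousLinearMap.smulRightL ℂ E E).continuous₂.comp
      (((innerSL ℂ).continuous.comp hv).prodMk hv)) (.of_compactSpace _)

theorem averagedProjection_apply {v : E} (hv : Continuous fun g => ρ g v) (x : E) :
    averagedProjection ρ v x =
      ∫ g, InnerProductSpace.rankOne ℂ (ρ g v) (ρ g v) x ∂(Measure.haar : Measure G) :=
  ContinuousLinearMap.integral_apply (integrable_rankOne_orbit hv) x

theorem averagedProjection_comm {v : E} (hv : Continuous fun g => ρ g v) (h : G) (x : E) :
    averagedProjection ρ v (ρ h x) = ρ h (averagedProjection ρ v x) := by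
  let P (g : G) : E →L[ℂ] E := InnerProductSpace.rankOne ℂ (ρ g v) (ρ g v)
  calc averagedProjection ρ v (ρ h x)
      = ∫ g, P (h * g) (ρ h x) ∂(Measure.haar : Measure G) := by
        rw [averagedProjection_apply hv, integral_mul_left_eq_self fun g => P g (ρ h x)]
    _ = ∫ g, ρ h (P g x) ∂(Measure.haar : Measure G) := by
        simp [P, map_mul]
    _ = ρ h (averagedProjection ρ v x) := by
        rw [averagedProjection_apply hv]
        exact (ρ h).toContinuousLinearEquiv.integral_comp_comm fun g => P g x

variable [CompleteSpace E]

theorem isCompactOperator_averagedProjection (v : E) :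
    IsCompactOperator (averagedProjection ρ v) :=
  isCompactOperator_integral fun _ => isCompactOperator_rankOne _ _

theorem inner_averagedProjection {v : E} (hv : Continuous fun g => ρ g v) (x y : E) :
    ⟪x, averagedProjection ρ v y⟫_ℂ =
      ∫ g, ⟪x, ρ g v⟫_ℂ * ⟪ρ g v, y⟫_ℂ ∂(Measure.haar : Measure G) := by
  rw [averagedProjection_apply hv,
    ← integral_inner ((integrable_rankOne_orbit hv).apply_continuousLinearMap y)]
  simp only [InnerProductSpace.inner_right_rankOne_apply]

theorem isSymmetric_averagedProjection {v : E} (hv : Continuous fun g => ρ g v) :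
    (averagedProjection ρ v).IsSymmetric := fun x y => by
  change ⟪averagedProjection ρ v x, y⟫_ℂ = ⟪x, averagedProjection ρ v y⟫_ℂ
  rw [← inner_conj_symm, inner_averagedProjection hv, inner_averagedProjection hv,
    ← integral_conj]
  simp only [map_mul, inner_conj_symm, mul_comm]

theorem averagedProjection_ne_zero {v : E} (hv : Continuous fun g => ρ g v) (hv0 : v ≠ 0) :
    averagedProjection ρ v ≠ 0 := by
  have inner_eq_integral : ⟪v, averagedProjection ρ v v⟫_ℂ =
      ((∫ g, ‖⟪ρ g v, v⟫_ℂ‖ ^ 2 ∂(Measure.haar : Measure G) : ℝ) : ℂ) := by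
    rw [inner_averagedProjection hv, ← integral_complex_ofReal]
    refine integral_congr_ae (.of_forall fun g => ?_)
    change ⟪v, ρ g v⟫_ℂ * ⟪ρ g v, v⟫_ℂ = _
    rw [← inner_conj_symm v, Complex.conj_mul', ← Complex.ofReal_pow]
  have integral_pos : 0 < ∫ g, ‖⟪ρ g v, v⟫_ℂ‖ ^ 2 ∂(Measure.haar : Measure G) :=
    Continuous.integral_pos_of_hasCompactSupport_nonneg_nonzero (x := 1) (by fun_prop)
      (.of_compactSpace _) (fun g => by positivity) (by simpa using hv0)
  intro h
  rw [h, zero_apply, inner_zero_right, eq_comm,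
    Complex.ofReal_eq_zero] at inner_eq_integral
  exact integral_pos.ne' inner_eq_integral

end AveragedProjection

section FiniteDimensionality

theorem exists_finiteDimensional_invariant_submodule {G E : Type*} [Group G] [TopologicalSpace G]
    [IsTopologicalGroup G] [CompactSpace G] [NormedAddCommGroup E] [InnerProductSpace ℂ E]
    [CompleteSpace E] [Nontrivial E] {ρ : G →* (E ≃ₗᵢ[ℂ] E)} (hρ : ∀ x, Continuous fun g => ρ g x) :
    ∃ K : Submodule ℂ E, FiniteDimensional ℂ K ∧ K ≠ ⊥ ∧ ∀ g, ∀ x ∈ K, ρ g x ∈ K := by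
  borelize G
  obtain ⟨v, hv⟩ := exists_ne (0 : E)
  have compact := isCompactOperator_averagedProjection (ρ := ρ) v
  obtain ⟨μ, hμ, hμ0⟩ :
      ∃ μ, Module.End.HasEigenvalue (averagedProjection ρ v).toLinearMap μ ∧ μ ≠ 0 := by
    by_contra! h
    exact averagedProjection_ne_zero (hρ v) hv <|
      (ContinuousLinearMap.eq_zero_of_forall_hasEigenvalue_eq_zero compact
        (isSymmetric_averagedProjection (hρ v))).1 h
  refine ⟨Module.End.eigenspace (averagedProjection ρ v).toLinearMap μ,
    ContinuousLinearMap.finite_dimensional_eigenspace compact μ hμ0, hμ, fun g x hx => ?_⟩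
  rw [Module.End.mem_eigenspace_iff, ContinuousLinearMap.coe_coe] at hx ⊢
  rw [averagedProjection_comm (hρ v), hx, map_smul]

end FiniteDimensionality

section UnitaryEquivalence

theorem exists_norm_map_eq_mul {𝕜 E F : Type*} [RCLike 𝕜] [NormedAddCommGroup E]
    [InnerProductSpace 𝕜 E] [NormedAddCommGroup F] [InnerProductSpace 𝕜 F] {L : E →ₗ[𝕜] F} {c : 𝕜}
    (hL : L ≠ 0) (hc : ∀ x, ⟪L x, L x⟫_𝕜 = c * ⟪x, x⟫_𝕜) : ∃ r > 0, ∀ x, ‖L x‖ = r * ‖x‖ := by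
  have norm_map (x : E) : ‖L x‖ = √‖c‖ * ‖x‖ := by
    have h := congrArg Norm.norm (hc x)
    rw [norm_mul, ← inner_self_re_eq_norm, ← inner_self_re_eq_norm, inner_self_eq_norm_sq,
      inner_self_eq_norm_sq] at h
    rw [← sq_eq_sq₀ (norm_nonneg _) (by positivity), mul_pow, Real.sq_sqrt (norm_nonneg c), h]
  refine ⟨√‖c‖, (Real.sqrt_nonneg _).lt_of_ne' fun h0 => hL (LinearMap.ext fun x => ?_), norm_map⟩
  exact norm_eq_zero.1 (by rw [norm_map, h0, zero_mul])

theorem exists_linearIsometryEquiv_eq_smul {𝕜 E F : Type*} [RCLike 𝕜] [NormedAddCommGroup E]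
    [NormedSpace 𝕜 E] [NormedAddCommGroup F] [NormedSpace 𝕜 F] (L : E ≃ₗ[𝕜] F) {r : ℝ}
    (hr : 0 < r) (hL : ∀ x, ‖L x‖ = r * ‖x‖) :
    ∃ (a : 𝕜) (U : E ≃ₗᵢ[𝕜] F), ∀ x, U x = a • L x := by
  have ha : (r : 𝕜)⁻¹ ≠ 0 := inv_ne_zero (RCLike.ofReal_ne_zero.2 hr.ne')
  refine ⟨(r : 𝕜)⁻¹, ⟨L.trans (LinearEquiv.smulOfNeZero 𝕜 F _ ha), fun x => ?_⟩, fun x => rfl⟩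
  change ‖(r : 𝕜)⁻¹ • L x‖ = ‖x‖
  rw [norm_smul, norm_inv, RCLike.norm_of_nonneg hr.le, hL, inv_mul_cancel_left₀ hr.ne']

theorem exists_inner_map_map_eq_mul {G E F : Type*} [Group G] [NormedAddCommGroup E]
    [InnerProductSpace ℂ E] [FiniteDimensional ℂ E] [NormedAddCommGroup F] [InnerProductSpace ℂ F]
    [FiniteDimensional ℂ F] {ρ : Representation ℂ G E} {σ : Representation ℂ G F}
    [ρ.IsIrreducible] (hρ : ∀ g, (ρ g).adjoint = ρ g⁻¹) (hσ : ∀ g, (σ g).adjoint = σ g⁻¹)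
    (S : IntertwiningMap ρ σ) : ∃ c : ℂ, ∀ x y, ⟪S x, S y⟫_ℂ = c * ⟪x, y⟫_ℂ := by
  let adjoint : IntertwiningMap σ ρ :=
    ⟨S.toLinearMap.adjoint, fun g => by
      have h := congrArg LinearMap.adjoint (S.isIntertwining' g⁻¹)
      rw [LinearMap.adjoint_comp, LinearMap.adjoint_comp, hρ, hσ, inv_inv] at h
      exact h.symm⟩
  obtain ⟨c, hc⟩ := (IsIrreducible.algebraMap_intertwiningMap_bijective_of_isAlgClosed
    (ρ := ρ)).2 (adjoint.comp S)
  have adjoint_map (y : E) : S.toLinearMap.adjoint (S.toLinearMap y) = c • y :=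
    congrArg (fun T : IntertwiningMap ρ ρ => T y) hc.symm
  refine ⟨c, fun x y => ?_⟩
  calc ⟪S x, S y⟫_ℂ = ⟪x, S.toLinearMap.adjoint (S.toLinearMap y)⟫_ℂ :=
        (LinearMap.adjoint_inner_right _ _ _).symm
    _ = c * ⟪x, y⟫_ℂ := by rw [adjoint_map, inner_smul_right]

end UnitaryEquivalence

namespace UnitaryIrrep

variable {G : Type u} [Group G] [TopologicalSpace G] {π σ : UnitaryIrrep.{u, v} G} {φ : G →* G}

theorem IsFixed.nonempty_equiv (h : π.IsFixed φ) :
    Nonempty (π.toRepresentation.Equiv (twist π.toRepresentation φ)) := by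
  obtain ⟨U, hU⟩ := h
  exact ⟨.mk U.toLinearEquiv fun g => LinearMap.ext (hU g)⟩

variable (π) in
theorem finiteDimensional [IsTopologicalGroup G] [CompactSpace G] :
    FiniteDimensional ℂ π.space := by
  have := π.nontrivial
  obtain ⟨K, hfin, hK, hinv⟩ := exists_finiteDimensional_invariant_submodule π.continuous_action
  have hKtop : K = ⊤ :=
    (π.irreducible K (Submodule.closed_of_finiteDimensional K) hinv).resolve_left hK
  exact Module.finite_def.2 (hKtop ▸ Module.Finite.iff_fg.1 hfin)

variable [FiniteDimensional ℂ π.space]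

instance isIrreducible_toRepresentation : π.toRepresentation.IsIrreducible where
  exists_pair_ne := by
    have := π.nontrivial
    exact ⟨⊥, ⊤, fun h => bot_ne_top (α := Submodule ℂ π.space)
      (congrArg Subrepresentation.toSubmodule h)⟩
  eq_bot_or_eq_top K :=
    (π.irreducible K.toSubmodule (Submodule.closed_of_finiteDimensional _)
      fun g _ hx => K.apply_mem_toSubmodule g hx).imp
      (fun h => Subrepresentation.toSubmodule_injective h)
      (fun h => Subrepresentation.toSubmodule_injective h)

theorem adjoint_toRepresentation (g : G) :
    (π.toRepresentation g).adjoint = π.toRepresentation g⁻¹ := by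
  refine ((LinearMap.eq_adjoint_iff _ _).2 fun x y => ?_).symm
  change ⟪π.action g⁻¹ x, y⟫_ℂ = ⟪x, π.action g y⟫_ℂ
  rw [← (π.action g).inner_map_map, map_inv]
  exact congrArg (⟪·, π.action g y⟫_ℂ) ((π.action g).apply_symm_apply x)

theorem toDual_eq_of_equiv [FiniteDimensional ℂ σ.space]
    (e : π.toRepresentation.Equiv σ.toRepresentation) : π.toDual = σ.toDual := by
  obtain ⟨c, hc⟩ := exists_inner_map_map_eq_mul adjoint_toRepresentation adjoint_toRepresentation
    e.toIntertwiningMap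
  have ne_zero : e.toIntertwiningMap.toLinearMap ≠ 0 := fun h =>
    toIntertwiningMap_ne_zero e (IntertwiningMap.ext h)
  obtain ⟨r, hr, hnorm⟩ := exists_norm_map_eq_mul ne_zero fun x => hc x x
  obtain ⟨a, U, hU⟩ := exists_linearIsometryEquiv_eq_smul e.toLinearEquiv hr hnorm
  refine Quotient.sound ⟨U, fun g x => ?_⟩
  have he : e.toLinearEquiv (π.action g x) = σ.action g (e.toLinearEquiv x) :=
    e.toIntertwiningMap.isIntertwining _ _ g x
  rw [hU, hU, he, map_smul]

end UnitaryIrrep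

theorem continuous_of_isMatrixCoefficient {G V : Type*} [Group G] [TopologicalSpace G]
    [NormedAddCommGroup V] [NormedSpace ℂ V] [FiniteDimensional ℂ V] {ρ : Representation ℂ G V}
    (hρ : ∀ x, Continuous fun g => ρ g x) {f : G → ℂ} (hf : IsMatrixCoefficient ρ f) :
    Continuous f := by
  obtain ⟨ℓ, hℓ⟩ := hf
  have continuous_ρ : Continuous fun g => LinearMap.toContinuousLinearMap (ρ g) :=
    continuous_clm_apply.2 hρ
  let ℓ' : (V →L[ℂ] V) →ₗ[ℂ] ℂ := ℓ ∘ₗ LinearMap.toContinuousLinearMap.symm.toLinearMap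
  rw [funext hℓ]
  exact ℓ'.continuous_of_finiteDimensional.comp continuous_ρ

section Rank

variable {K : Type*} [Field K]

theorem toENat_rank_fun (ι : Type*) : (Module.rank K (ι → K)).toENat = ENat.card ι := by
  cases finite_or_infinite ι
  · have := Fintype.ofFinite ι
    rw [rank_fun', Cardinal.toENat_nat, ENat.card_eq_coe_fintype_card]
  · rw [rank_fun_infinite, ENat.card_eq_top_of_infinite, Cardinal.toENat_eq_top,
      Cardinal.aleph0_le_mk_iff]
    infer_instance

theorem toENat_rank_span_range {V ι : Type*} [AddCommGroup V] [Module K V] {v : ι → V}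
    (hv : LinearIndependent K v) :
    (Module.rank K (Submodule.span K (Set.range v))).toENat = ENat.card ι := by
  rw [rank_span hv]
  exact (ENat.card_congr (Equiv.ofInjective v hv.injective)).symm

theorem eq_of_le_of_toENat_rank_eq {V : Type*} [AddCommGroup V] [Module K V] {S T : Submodule K V}
    (hle : S ≤ T) (hT : (Module.rank K T).toENat < ⊤)
    (h : (Module.rank K S).toENat = (Module.rank K T).toENat) : S = T := by
  have : FiniteDimensional K T := Module.rank_lt_aleph0_iff.1 (Cardinal.toENat_lt_top.1 hT)
  refine Submodule.eq_of_le_of_finrank_eq hle ?_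
  rw [Module.finrank, Module.finrank, ← Cardinal.toNat_toENat, h, Cardinal.toNat_toENat]

end Rank

section ClassFunctions

variable {G : Type*} [Group G] {φ : G →* G}

/-- Class functions as arbitrary functions on the set of Reidemeister classes. -/
def classFunctionsEquiv (φ : G →* G) : (Quotient (twistedConj φ) → ℂ) ≃ₗ[ℂ] classFunctions φ where
  toFun F := ⟨fun g => F (Quotient.mk _ g), fun _ _ h => congrArg F (Quotient.sound h)⟩
  map_add' _ _ := rfl
  map_smul' _ _ := rfl
  invFun f := Quotient.lift f.1 f.2
  left_inv _ := funext fun q => q.inductionOn fun _ => rfl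
  right_inv _ := rfl

theorem toENat_rank_classFunctions :
    (Module.rank ℂ (classFunctions φ)).toENat = reidemeisterNumber φ := by
  rw [reidemeisterNumber, ← toENat_rank_fun (K := ℂ)]
  exact congrArg Cardinal.toENat (classFunctionsEquiv φ).rank_eq.symm

theorem finite_quotient_of_continuous [TopologicalSpace G] [CompactSpace G]
    (h : ∀ f ∈ classFunctions φ, Continuous f) : Finite (Quotient (twistedConj φ)) := by
  have : DiscreteTopology (Quotient (twistedConj φ)) := by
    refine discreteTopology_iff_forall_isOpen.2 fun s => ?_
    let f := classFunctionsEquiv φ (s.indicator 1)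
    have preimage_eq : Quotient.mk (twistedConj φ) ⁻¹' s = f.1 ⁻¹' {0}ᶜ :=
      Set.ext fun g => by
        change ⟦g⟧ ∈ s ↔ s.indicator (1 : Quotient (twistedConj φ) → ℂ) ⟦g⟧ ≠ 0
        simp
    rw [← isQuotientMap_quotient_mk'.isOpen_preimage]
    exact preimage_eq ▸ isOpen_compl_singleton.preimage (h f.1 f.2)
  exact finite_of_compact_of_discrete

end ClassFunctions

section CoefficientSystems

variable {G : Type u} [Group G] [TopologicalSpace G] {φ : G →* G}
  {T : FixedPoint.{u, v} φ → G → ℂ}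

theorem IsCoefficientSystem.span_le (hT : IsCoefficientSystem φ T) :
    Submodule.span ℂ (Set.range T) ≤ classFunctions φ :=
  Submodule.span_le.2 (Set.range_subset_iff.2 fun p => (hT p).2.1)

variable [IsTopologicalGroup G] [CompactSpace G]

theorem exists_isCoefficientSystem (φ : G →* G) :
    ∃ T : FixedPoint.{u, v} φ → G → ℂ, IsCoefficientSystem φ T := by
  have exists_coefficient (p : FixedPoint.{u, v} φ) : ∃ f : G → ℂ, f ≠ 0 ∧ f ∈ classFunctions φ ∧
      ∃ π : UnitaryIrrep.{u, v} G, π.toDual = p.1 ∧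
        IsMatrixCoefficient π.toRepresentation f := by
    obtain ⟨π, hπ, hfix⟩ := p.2
    have := π.finiteDimensional
    obtain ⟨f, hf, hc, hm⟩ := nonempty_equiv_twist_iff.1 hfix.nonempty_equiv
    exact ⟨f, hf, hc, π, hπ, hm⟩
  choose T hT using exists_coefficient
  exact ⟨T, hT⟩

theorem IsCoefficientSystem.linearIndependent (hT : IsCoefficientSystem φ T) :
    LinearIndependent ℂ T := by
  choose hT0 _ π hπ hm using hT
  have (p : FixedPoint.{u, v} φ) : FiniteDimensional ℂ (π p).space := (π p).finiteDimensional
  refine linearIndependent_of_isMatrixCoefficient (fun p => (π p).toRepresentation)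
    (fun p q hpq => ⟨fun e => hpq (Subtype.ext ?_)⟩) hT0 hm
  rw [← hπ p, ← hπ q, UnitaryIrrep.toDual_eq_of_equiv e]

theorem IsCoefficientSystem.toENat_rank_span (hT : IsCoefficientSystem φ T) :
    (Module.rank ℂ (Submodule.span ℂ (Set.range T))).toENat = fixedPointNumber.{u, v} φ :=
  toENat_rank_span_range hT.linearIndependent

theorem IsCoefficientSystem.continuous_of_mem_span (hT : IsCoefficientSystem φ T) {f : G → ℂ}
    (hf : f ∈ Submodule.span ℂ (Set.range T)) : Continuous f := by
  induction hf using Submodule.span_induction with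
  | mem f hf =>
    obtain ⟨p, rfl⟩ := hf
    obtain ⟨-, -, π, -, hm⟩ := hT p
    have := π.finiteDimensional
    exact continuous_of_isMatrixCoefficient π.continuous_action hm
  | zero => exact continuous_zero
  | add _ _ _ _ hf hg => exact hf.add hg
  | smul c _ _ hf => exact hf.const_smul c

theorem IsCoefficientSystem.finite_and_tbft_iff (hT : IsCoefficientSystem φ T) :
    ((reidemeisterNumber φ < ⊤ ∨ fixedPointNumber.{u, v} φ < ⊤) ∧ TBFT.{u, v} φ) ↔
      (LinearIndependent ℂ T ∧ Submodule.span ℂ (Set.range T) = classFunctions φ) := by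
  constructor
  · rintro ⟨hfin, htbft⟩
    have number_eq := htbft hfin
    rw [← number_eq, or_self] at hfin
    refine ⟨hT.linearIndependent, eq_of_le_of_toENat_rank_eq hT.span_le ?_ ?_⟩
    · rwa [toENat_rank_classFunctions]
    · rw [toENat_rank_classFunctions, hT.toENat_rank_span, number_eq]
  · rintro ⟨-, hspan⟩
    have : Finite (Quotient (twistedConj φ)) :=
      finite_quotient_of_continuous fun f hf => hT.continuous_of_mem_span (hspan ▸ hf)
    refine ⟨Or.inl (ENat.card_lt_top.2 this), fun _ => ?_⟩
    rw [← toENat_rank_classFunctions, ← hspan, hT.toENat_rank_span]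

end CoefficientSystems

end Reidemeister

theorem mainTheorem9_general {G : Type u} [Group G] [TopologicalSpace G]
    [IsTopologicalGroup G] [CompactSpace G] (φ : G →* G) :
    (∀ (V : Type w) [AddCommGroup V] [Module ℂ V] [FiniteDimensional ℂ V]
        (ρ : Representation ℂ G V), ρ.IsIrreducible →
      (Nonempty (ρ.Equiv (Reidemeister.twist ρ φ)) ↔
        ∃ f : G → ℂ, f ≠ 0 ∧ f ∈ Reidemeister.classFunctions φ ∧
          Reidemeister.IsMatrixCoefficient ρ f) ∧
      (Nonempty (ρ.Equiv (Reidemeister.twist ρ φ)) →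
        (∀ f₁ f₂ : G → ℂ,
          f₁ ≠ 0 → f₁ ∈ Reidemeister.classFunctions φ → Reidemeister.IsMatrixCoefficient ρ f₁ →
          f₂ ∈ Reidemeister.classFunctions φ → Reidemeister.IsMatrixCoefficient ρ f₂ →
          ∃ c : ℂ, f₂ = c • f₁) ∧
        (∀ f : G → ℂ,
          (f ≠ 0 ∧ f ∈ Reidemeister.classFunctions φ ∧ Reidemeister.IsMatrixCoefficient ρ f) ↔
          ∃ S : Representation.IntertwiningMap ρ (Reidemeister.twist ρ φ),
            S ≠ 0 ∧ f = Reidemeister.traceFunction ρ S.toLinearMap))) ∧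
    (∃ T : Reidemeister.FixedPoint.{u, v} φ → G → ℂ, Reidemeister.IsCoefficientSystem φ T) ∧
    (∀ T : Reidemeister.FixedPoint.{u, v} φ → G → ℂ, Reidemeister.IsCoefficientSystem φ T →
      (((Reidemeister.reidemeisterNumber φ < ⊤ ∨ Reidemeister.fixedPointNumber.{u, v} φ < ⊤) ∧
          Reidemeister.TBFT.{u, v} φ) ↔
        (LinearIndependent ℂ T ∧
          Submodule.span ℂ (Set.range T) = Reidemeister.classFunctions φ))) := by
  refine ⟨fun V _ _ _ ρ _ => ⟨Reidemeister.nonempty_equiv_twist_iff, fun _ => ⟨?_, fun _ =>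
    Reidemeister.ne_zero_and_mem_and_isMatrixCoefficient_iff⟩⟩,
    Reidemeister.exists_isCoefficientSystem φ, fun T hT => hT.finite_and_tbft_iff⟩
  exact fun f₁ f₂ => Reidemeister.exists_eq_smul_of_isMatrixCoefficient

theorem mainTheorem9 {G : Type u} [Group G] [TopologicalSpace G]
    [IsTopologicalGroup G] [CompactSpace G] [T2Space G] (φ : G →* G) :
    -- a single finite-dimensional irreducible representation
    (∀ (V : Type w) [NormedAddCommGroup V] [NormedSpace ℂ V] [FiniteDimensional ℂ V]
        (ρ : Representation ℂ G V), (∀ x : V, Continuous fun g => ρ g x) → ρ.IsIrreducible →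
      (Nonempty (ρ.Equiv (Reidemeister.twist ρ φ)) ↔
        ∃ f : G → ℂ, f ≠ 0 ∧ f ∈ Reidemeister.classFunctions φ ∧
          Reidemeister.IsMatrixCoefficient ρ f) ∧
      (Nonempty (ρ.Equiv (Reidemeister.twist ρ φ)) →
        (∀ f₁ f₂ : G → ℂ,
          f₁ ≠ 0 → f₁ ∈ Reidemeister.classFunctions φ → Reidemeister.IsMatrixCoefficient ρ f₁ →
          f₂ ∈ Reidemeister.classFunctions φ → Reidemeister.IsMatrixCoefficient ρ f₂ →
          ∃ c : ℂ, f₂ = c • f₁) ∧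
        (∀ f : G → ℂ,
          (f ≠ 0 ∧ f ∈ Reidemeister.classFunctions φ ∧ Reidemeister.IsMatrixCoefficient ρ f) ↔
          ∃ S : Representation.IntertwiningMap ρ (Reidemeister.twist ρ φ),
            S ≠ 0 ∧ f = Reidemeister.traceFunction ρ S.toLinearMap))) ∧
    -- the twisted Burnside–Frobenius theorem
    (∃ T : Reidemeister.FixedPoint.{u, v} φ → G → ℂ, Reidemeister.IsCoefficientSystem φ T) ∧
    (∀ T : Reidemeister.FixedPoint.{u, v} φ → G → ℂ, Reidemeister.IsCoefficientSystem φ T →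
      (((Reidemeister.reidemeisterNumber φ < ⊤ ∨ Reidemeister.fixedPointNumber.{u, v} φ < ⊤) ∧
          Reidemeister.TBFT.{u, v} φ) ↔
        (LinearIndependent ℂ T ∧
          Submodule.span ℂ (Set.range T) = Reidemeister.classFunctions φ))) := by
  obtain ⟨h_irreducible, h_tbft⟩ := mainTheorem9_general φ
  exact ⟨fun V _ _ _ ρ _ hρ => h_irreducible V ρ hρ, h_tbft⟩
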